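/- Let $M$ be a smooth manifold, and let $TM\oplus T^*M$ carry the pairing $\langle X+\xi,Y+\eta\rangle=\eta(X)+\xi(Y)$ and the Courant bracket $$[X+\xi,Y+\eta]_C=[X,Y]+\mathcal L_X\eta-\mathcal L_Y\xi-\tfrac12 d(\iota_X\eta-\iota_Y\xi).$$ A generalized almost para-complex structure is a smooth endomorphism $\mathfrak P$ of $TM\oplus T^*M$ such that $\mathfrak P^2=\mathrm{Id}$, $\langle\mathfrak Pv,\mathfrak Pw\rangle=\langle v,w\rangle$ for all $v,w$, and the $\pm1$-eigenbundles of $\mathfrak P$ have the same rank. Let $\mathfrak P=\begin{bmatrix}H&\alpha\\ \beta&K\end{bmatrix}$ be such a structure, with $H:TM\to TM$, $\alpha:T^*M\to TM$, $\beta:TM\to T^*M$, $K:T^*M\to T^*M$, and suppose that $\alpha$ is invertible. For a vector field $X$ put $$X^{\pm}=X\pm\alpha^{-1}X-\alpha^{-1}HX,$$ which is a section of the $\pm1$-eigenbundle, and let $\nabla^+$ be the affine connection on $M$ given by $$\nabla^+_XY=\pi\Big(\tfrac12(\mathrm{Id}+\mathfrak P)\,[X^-,Y^+]_C\Big),$$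 where $\pi:TM\oplus T^*M\to TM$ is the projection; denote also by $\nabla^+$ the dual connection on $T^*M$. Let $$[X+\xi,Y+\eta]_{\nabla^+}=[X,Y]+\nabla^+_X\eta-\nabla^+_Y\xi .$$ If $\nabla^+\alpha=0$, $\nabla^+H=0$ and the $2$-form $\alpha^{-1}H$, $(X,Y)\mapsto(\alpha^{-1}HX)(Y)$, satisfies $d(\alpha^{-1}H)=0$, then $\mathfrak P$ is $[\cdot,\cdot]_{\nabla^+}$-integrable, i.e. $$[\mathfrak Pv,\mathfrak Pw]_{\nabla^+}-\mathfrak P[\mathfrak Pv,w]_{\nabla^+}-\mathfrak P[v,\mathfrak Pw]_{\nabla^+}+\mathfrak P^2[v,w]_{\nabla^+}=0$$ for all smooth sections $v,w$ of $TM\oplus T^*M$. -/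

import Mathlib

open Bundle
open scoped Manifold ContDiff

noncomputable section

namespace GenGeom

variable {E : Type*} [NormedAddCommGroup E] [NormedSpace ℝ E]
  {H : Type*} [TopologicalSpace H] (I : ModelWithCorners ℝ E H)
  {M : Type*} [TopologicalSpace M] [ChartedSpace H M]

/-! ### Vector fields, one-forms and the generalized tangent bundle -/

/-- The cotangent space `T*_x M`. -/
abbrev Cotangent (x : M) : Type _ := TangentSpace I x →L[ℝ] ℝ

/-- The fibre `T_x M ⊕ T*_x M` of the generalized tangent bundle. -/
abbrev GT (x : M) : Type _ := TangentSpace I x × Cotangent I x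

/-- Smoothness of a vector field. -/
def IsSmoothVF [IsManifold I ∞ M] (X : Π x : M, TangentSpace I x) : Prop :=
  ContMDiff I (I.prod 𝓘(ℝ, E)) ∞ (fun x ↦ TotalSpace.mk' E x (X x))

/-- Smoothness of a one-form, as a section of the cotangent bundle. -/
def IsSmoothForm [IsManifold I ∞ M] (η : Π x : M, Cotangent I x) : Prop :=
  ContMDiff I (I.prod 𝓘(ℝ, E →L[ℝ] ℝ)) ∞
    (fun x ↦ TotalSpace.mk' (E →L[ℝ] ℝ) (E := fun x : M ↦ Cotangent I x) x (η x))

/-- Smoothness of a section `X + ξ` of `TM ⊕ T*M`. -/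
def IsSmoothSection [IsManifold I ∞ M] (v : Π x : M, GT I x) : Prop :=
  IsSmoothVF I (fun x ↦ (v x).1) ∧ IsSmoothForm I (fun x ↦ (v x).2)

variable {I}

/-- The natural pairing `⟨X + ξ, Y + η⟩ = η(X) + ξ(Y)`. -/
def pairing {x : M} (u v : GT I x) : ℝ := v.2 u.1 + u.2 v.1

/-- The derivative `X(f)` of a function along a vector field. -/
def dirDeriv (X : Π x : M, TangentSpace I x) (f : M → ℝ) (x : M) : ℝ :=
  mvfderiv I f x (X x)

/-- The function `ι_X η = η(X)`. -/
def contr (η : Π x : M, Cotangent I x) (X : Π x : M, TangentSpace I x) (x : M) : ℝ :=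
  η x (X x)

theorem contr_mdifferentiableAt [IsManifold I ∞ M] {η : Π x : M, Cotangent I x} {Z : Π x : M, TangentSpace I x}
    {x : M}
    (hη : MDifferentiableAt I (I.prod 𝓘(ℝ, E →L[ℝ] ℝ))
      (fun y ↦ TotalSpace.mk' (E →L[ℝ] ℝ) (E := fun x : M ↦ Cotangent I x) y (η y)) x)
    (hZ : MDifferentiableAt I (I.prod 𝓘(ℝ, E)) (fun y ↦ TotalSpace.mk' E y (Z y)) x) :
    MDifferentiableAt I 𝓘(ℝ, ℝ) (contr η Z) x := by
  have h : MDifferentiableAt I (I.prod 𝓘(ℝ, ℝ))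
      (fun m ↦ TotalSpace.mk' ℝ (E := Bundle.Trivial M ℝ) m (η m (Z m))) x :=
    MDifferentiableAt.clm_bundle_apply (F₁ := E) (F₂ := ℝ) (E₂ := Bundle.Trivial M ℝ) hη hZ
  simp only [mdifferentiableAt_totalSpace] at h
  exact h.2

section Differential

variable [FiniteDimensional ℝ E] [IsManifold I ∞ M]

open Classical in
/-- The one-form defined by a function-linear operation `Φ` on vector fields: at each point `x`
where `Φ` is tensorial, it is the covector `ω_x` with `ω_x (Z x) = Φ Z x` for every vector field `Z`
that is differentiable at `x`. (Where `Φ` is not tensorial the value is `0`.) -/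
def formOf (Φ : (Π x : M, TangentSpace I x) → M → ℝ) (x : M) : Cotangent I x :=
  if h : TensorialAt I E (fun Z ↦ Φ Z x) x then TensorialAt.mkHom (fun Z ↦ Φ Z x) x h else 0

theorem formOf_apply {Φ : (Π x : M, TangentSpace I x) → M → ℝ} {x : M}
    (h : TensorialAt I E (fun Z ↦ Φ Z x) x) {Z : Π x : M, TangentSpace I x}
    (hZ : MDifferentiableAt I (I.prod 𝓘(ℝ, E)) (fun y ↦ TotalSpace.mk' E y (Z y)) x) :
    formOf Φ x (Z x) = Φ Z x := by
  rw [formOf, dif_pos h]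
  exact TensorialAt.mkHom_apply h hZ

/-- The Lie derivative of a one-form: `(𝓛_X η)(Z) = X(η(Z)) - η([X, Z])`. -/
def lieDerivForm (X : Π x : M, TangentSpace I x) (η : Π x : M, Cotangent I x) :
    Π x : M, Cotangent I x :=
  formOf fun Z x ↦ dirDeriv X (contr η Z) x - η x (VectorField.mlieBracket I X Z x)

/-- The Lie derivative of a one-form is given by the usual formula on vector fields. -/
theorem lieDerivForm_apply {X : Π x : M, TangentSpace I x} {η : Π x : M, Cotangent I x} {x : M}
    (hη : MDifferentiableAt I (I.prod 𝓘(ℝ, E →L[ℝ] ℝ))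
      (fun y ↦ TotalSpace.mk' (E →L[ℝ] ℝ) (E := fun x : M ↦ Cotangent I x) y (η y)) x)
    {Z : Π x : M, TangentSpace I x}
    (hZ : MDifferentiableAt I (I.prod 𝓘(ℝ, E)) (fun y ↦ TotalSpace.mk' E y (Z y)) x) :
    lieDerivForm X η x (Z x) =
      dirDeriv X (contr η Z) x - η x (VectorField.mlieBracket I X Z x) := by
  refine formOf_apply ⟨?_, ?_⟩ hZ
  · intro f Z hf hZ
    have e : contr η (f • Z) = f * contr η Z := by
      funext y; simp [contr]
    rw [e, VectorField.mlieBracket_smul_right hf hZ, dirDeriv, dirDeriv,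
      mvfderiv_mul hf (contr_mdifferentiableAt hη hZ)]
    simp [contr]
    ring
  · intro Z Z' hZ hZ'
    have e : contr η (Z + Z') = contr η Z + contr η Z' := by
      funext y; simp [contr]
    rw [e, VectorField.mlieBracket_add_right hZ hZ', dirDeriv, dirDeriv, dirDeriv,
      mvfderiv_add (contr_mdifferentiableAt hη hZ) (contr_mdifferentiableAt hη hZ')]
    simp only [add_apply, map_add]
    ring

/-- The Courant bracket
`[X + ξ, Y + η]_C = [X, Y] + 𝓛_X η - 𝓛_Y ξ - ½ d(ι_X η - ι_Y ξ)`. -/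
def courant (v w : Π x : M, GT I x) (x : M) : GT I x :=
  (VectorField.mlieBracket I (fun y ↦ (v y).1) (fun y ↦ (w y).1) x,
    lieDerivForm (fun y ↦ (v y).1) (fun y ↦ (w y).2) x
      - lieDerivForm (fun y ↦ (w y).1) (fun y ↦ (v y).2) x
      - (1 / 2 : ℝ) • mvfderiv I
          (fun y ↦ (w y).2 (v y).1 - (v y).2 (w y).1) x)

/-- The connection on one-forms dual to `∇`: `(∇_X η)(Z) = X(η(Z)) - η(∇_X Z)`. -/
def dualConn (nabla : (Π x : M, TangentSpace I x) → (Π x : M, TangentSpace I x) →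
      (Π x : M, TangentSpace I x))
    (X : Π x : M, TangentSpace I x) (η : Π x : M, Cotangent I x) : Π x : M, Cotangent I x :=
  formOf fun Z x ↦ dirDeriv X (contr η Z) x - η x (nabla X Z x)

/-- For an operation that is additive and satisfies the Leibniz rule in its second argument (as a
connection is), the dual connection is given by the usual formula on vector fields. -/
theorem dualConn_apply {nabla : (Π x : M, TangentSpace I x) → (Π x : M, TangentSpace I x) →
      (Π x : M, TangentSpace I x)} {X : Π x : M, TangentSpace I x} {x : M}
    (hadd : ∀ {Z Z' : Π x : M, TangentSpace I x},
      MDifferentiableAt I (I.prod 𝓘(ℝ, E)) (fun y ↦ TotalSpace.mk' E y (Z y)) x →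
      MDifferentiableAt I (I.prod 𝓘(ℝ, E)) (fun y ↦ TotalSpace.mk' E y (Z' y)) x →
      nabla X (Z + Z') x = nabla X Z x + nabla X Z' x)
    (hleib : ∀ {f : M → ℝ} {Z : Π x : M, TangentSpace I x}, MDifferentiableAt I 𝓘(ℝ, ℝ) f x →
      MDifferentiableAt I (I.prod 𝓘(ℝ, E)) (fun y ↦ TotalSpace.mk' E y (Z y)) x →
      nabla X (f • Z) x = f x • nabla X Z x + dirDeriv X f x • Z x)
    {η : Π x : M, Cotangent I x}
    (hη : MDifferentiableAt I (I.prod 𝓘(ℝ, E →L[ℝ] ℝ))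
      (fun y ↦ TotalSpace.mk' (E →L[ℝ] ℝ) (E := fun x : M ↦ Cotangent I x) y (η y)) x)
    {Z : Π x : M, TangentSpace I x}
    (hZ : MDifferentiableAt I (I.prod 𝓘(ℝ, E)) (fun y ↦ TotalSpace.mk' E y (Z y)) x) :
    dualConn nabla X η x (Z x) = dirDeriv X (contr η Z) x - η x (nabla X Z x) := by
  refine formOf_apply ⟨?_, ?_⟩ hZ
  · intro f Z hf hZ
    have e : contr η (f • Z) = f * contr η Z := by
      funext y; simp [contr]
    rw [e, hleib hf hZ, dirDeriv, dirDeriv, dirDeriv,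
      mvfderiv_mul hf (contr_mdifferentiableAt hη hZ)]
    simp [contr]
    ring
  · intro Z Z' hZ hZ'
    have e : contr η (Z + Z') = contr η Z + contr η Z' := by
      funext y; simp [contr]
    rw [e, hadd hZ hZ', dirDeriv, dirDeriv, dirDeriv,
      mvfderiv_add (contr_mdifferentiableAt hη hZ) (contr_mdifferentiableAt hη hZ')]
    simp only [add_apply, map_add]
    ring

/-- The bracket `[X + ξ, Y + η]_∇ = [X, Y] + ∇_X η - ∇_Y ξ` on sections of `TM ⊕ T*M` induced by a
connection `∇` on `TM`. -/
def connBracket (nabla : (Π x : M, TangentSpace I x) → (Π x : M, TangentSpace I x) →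
      (Π x : M, TangentSpace I x)) (v w : Π x : M, GT I x) (x : M) : GT I x :=
  (VectorField.mlieBracket I (fun y ↦ (v y).1) (fun y ↦ (w y).1) x,
    dualConn nabla (fun y ↦ (v y).1) (fun y ↦ (w y).2) x
      - dualConn nabla (fun y ↦ (w y).1) (fun y ↦ (v y).2) x)

end Differential

/-- The exterior derivative of a two-form `b`, evaluated on three vector fields:
`db(X, Y, Z) = X b(Y, Z) - Y b(X, Z) + Z b(X, Y) - b([X, Y], Z) + b([X, Z], Y) - b([Y, Z], X)`. -/
def extDerivTwo (b : Π x : M, TangentSpace I x →L[ℝ] Cotangent I x)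
    (X Y Z : Π x : M, TangentSpace I x) (x : M) : ℝ :=
  dirDeriv X (fun y ↦ b y (Y y) (Z y)) x - dirDeriv Y (fun y ↦ b y (X y) (Z y)) x
    + dirDeriv Z (fun y ↦ b y (X y) (Y y)) x
    - b x (VectorField.mlieBracket I X Y x) (Z x) + b x (VectorField.mlieBracket I X Z x) (Y x)
    - b x (VectorField.mlieBracket I Y Z x) (X x)

/-! ### Endomorphisms of the generalized tangent bundle -/

/-- The block `TM → TM` of an endomorphism `P = [[H, α], [β, K]]`. -/
def blockH (P : Π x : M, GT I x →L[ℝ] GT I x) (x : M) : TangentSpace I x →L[ℝ] TangentSpace I x :=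
  ContinuousLinearMap.fst ℝ _ _ ∘L P x ∘L ContinuousLinearMap.inl ℝ _ _

/-- The block `T*M → TM`. -/
def blockAlpha (P : Π x : M, GT I x →L[ℝ] GT I x) (x : M) : Cotangent I x →L[ℝ] TangentSpace I x :=
  ContinuousLinearMap.fst ℝ _ _ ∘L P x ∘L ContinuousLinearMap.inr ℝ _ _

/-- The block `TM → T*M`. -/
def blockBeta (P : Π x : M, GT I x →L[ℝ] GT I x) (x : M) : TangentSpace I x →L[ℝ] Cotangent I x :=
  ContinuousLinearMap.snd ℝ _ _ ∘L P x ∘L ContinuousLinearMap.inl ℝ _ _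

/-- The block `T*M → T*M`. -/
def blockK (P : Π x : M, GT I x →L[ℝ] GT I x) (x : M) : Cotangent I x →L[ℝ] Cotangent I x :=
  ContinuousLinearMap.snd ℝ _ _ ∘L P x ∘L ContinuousLinearMap.inr ℝ _ _

/-- Smoothness of a bundle endomorphism of `TM ⊕ T*M`: its four blocks are smooth sections of the
corresponding bundles of homomorphisms. -/
structure IsSmoothEnd [IsManifold I ∞ M] (P : Π x : M, GT I x →L[ℝ] GT I x) : Prop where
  smooth_H : ContMDiff I (I.prod 𝓘(ℝ, E →L[ℝ] E)) ∞
    (fun x ↦ TotalSpace.mk' (E →L[ℝ] E)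
      (E := fun x : M ↦ TangentSpace I x →L[ℝ] TangentSpace I x) x (blockH P x))
  smooth_alpha : ContMDiff I (I.prod 𝓘(ℝ, (E →L[ℝ] ℝ) →L[ℝ] E)) ∞
    (fun x ↦ TotalSpace.mk' ((E →L[ℝ] ℝ) →L[ℝ] E)
      (E := fun x : M ↦ Cotangent I x →L[ℝ] TangentSpace I x) x (blockAlpha P x))
  smooth_beta : ContMDiff I (I.prod 𝓘(ℝ, E →L[ℝ] (E →L[ℝ] ℝ))) ∞
    (fun x ↦ TotalSpace.mk' (E →L[ℝ] (E →L[ℝ] ℝ))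
      (E := fun x : M ↦ TangentSpace I x →L[ℝ] Cotangent I x) x (blockBeta P x))
  smooth_K : ContMDiff I (I.prod 𝓘(ℝ, (E →L[ℝ] ℝ) →L[ℝ] (E →L[ℝ] ℝ))) ∞
    (fun x ↦ TotalSpace.mk' ((E →L[ℝ] ℝ) →L[ℝ] (E →L[ℝ] ℝ))
      (E := fun x : M ↦ Cotangent I x →L[ℝ] Cotangent I x) x (blockK P x))

/-- A generalized almost para-complex structure: a smooth endomorphism `P` of `TM ⊕ T*M` with
`P² = Id`, orthogonal for the natural pairing, whose eigenbundles for `1` and `-1` have the same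
rank. -/
structure IsGenAlmostParaComplex [IsManifold I ∞ M] (P : Π x : M, GT I x →L[ℝ] GT I x) :
    Prop where
  smooth : IsSmoothEnd P
  sq_eq_id : ∀ (x : M) (v : GT I x), P x (P x v) = v
  orthogonal : ∀ (x : M) (v w : GT I x), pairing (P x v) (P x w) = pairing v w
  rank_eq : ∀ x : M,
    Module.finrank ℝ (Module.End.eigenspace (P x : GT I x →ₗ[ℝ] GT I x) 1) =
      Module.finrank ℝ (Module.End.eigenspace (P x : GT I x →ₗ[ℝ] GT I x) (-1))

/-- `α⁻¹ : TM → T*M` (meaningful when `α` is invertible). -/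
def alphaInv (P : Π x : M, GT I x →L[ℝ] GT I x) (x : M) : TangentSpace I x →L[ℝ] Cotangent I x :=
  (blockAlpha P x).inverse

/-- The two-form `α⁻¹ H`, `(X, Y) ↦ (α⁻¹ H X)(Y)`. -/
def alphaInvH (P : Π x : M, GT I x →L[ℝ] GT I x) (x : M) : TangentSpace I x →L[ℝ] Cotangent I x :=
  alphaInv P x ∘L blockH P x

/-- The lift `X⁺ = X + α⁻¹ X - α⁻¹ H X` of a vector field to `V⁺`. -/
def liftPlus (P : Π x : M, GT I x →L[ℝ] GT I x) (X : Π x : M, TangentSpace I x) (x : M) :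
    GT I x :=
  (X x, alphaInv P x (X x) - alphaInvH P x (X x))

/-- The lift `X⁻ = X - α⁻¹ X - α⁻¹ H X` of a vector field to `V⁻`. -/
def liftMinus (P : Π x : M, GT I x →L[ℝ] GT I x) (X : Π x : M, TangentSpace I x) (x : M) :
    GT I x :=
  (X x, -alphaInv P x (X x) - alphaInvH P x (X x))

/-- The projection `½ (Id + P)` onto the eigenbundle `V⁺`. -/
def projPlus (P : Π x : M, GT I x →L[ℝ] GT I x) (x : M) (v : GT I x) : GT I x :=
  (1 / 2 : ℝ) • (v + P x v)

section Connection

variable [FiniteDimensional ℝ E] [IsManifold I ∞ M]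

/-- The connection on `TM` induced by `P`: `∇⁺_X Y = π(([X⁻, Y⁺]_C)₊)`. -/
def nablaPlus (P : Π x : M, GT I x →L[ℝ] GT I x) (X Y : Π x : M, TangentSpace I x) (x : M) :
    TangentSpace I x :=
  (projPlus P x (courant (liftMinus P X) (liftPlus P Y) x)).1

/-- `∇H = 0` for a field `H` of endomorphisms of `TM`: `(∇_X H)(Y) = ∇_X (H Y) - H (∇_X Y) = 0` for
all smooth vector fields `X`, `Y`. -/
def IsParallelTT (nabla : (Π x : M, TangentSpace I x) → (Π x : M, TangentSpace I x) →
      (Π x : M, TangentSpace I x))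
    (A : Π x : M, TangentSpace I x →L[ℝ] TangentSpace I x) : Prop :=
  ∀ X Y : Π x : M, TangentSpace I x, IsSmoothVF I X → IsSmoothVF I Y →
    ∀ x, nabla X (fun y ↦ A y (Y y)) x - A x (nabla X Y x) = 0

/-- `∇α = 0` for a bundle map `α : T*M → TM`: `(∇_X α)(η) = ∇_X (α η) - α (∇_X η) = 0` for all
smooth vector fields `X` and smooth one-forms `η`. -/
def IsParallelCT (nabla : (Π x : M, TangentSpace I x) → (Π x : M, TangentSpace I x) →
      (Π x : M, TangentSpace I x))
    (A : Π x : M, Cotangent I x →L[ℝ] TangentSpace I x) : Prop :=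
  ∀ (X : Π x : M, TangentSpace I x) (η : Π x : M, Cotangent I x),
    IsSmoothVF I X → IsSmoothForm I η →
    ∀ x, nabla X (fun y ↦ A y (η y)) x - A x (dualConn nabla X η x) = 0

end Connection

/-- A two-form is closed: its exterior derivative vanishes on all smooth vector fields. -/
def IsClosedTwo [IsManifold I ∞ M] (b : Π x : M, TangentSpace I x →L[ℝ] Cotangent I x) : Prop :=
  ∀ X Y Z : Π x : M, TangentSpace I x, IsSmoothVF I X → IsSmoothVF I Y → IsSmoothVF I Z →
    ∀ x, extDerivTwo b X Y Z x = 0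

/-- The Nijenhuis operator of an endomorphism `P` with respect to a bracket on sections:
`N_P(v, w) = [Pv, Pw] - P[Pv, w] - P[v, Pw] + P²[v, w]`. -/
def nijenhuis
    (br : (Π x : M, GT I x) → (Π x : M, GT I x) → (Π x : M, GT I x))
    (P : Π x : M, GT I x →L[ℝ] GT I x) (v w : Π x : M, GT I x) (x : M) : GT I x :=
  br (fun y ↦ P y (v y)) (fun y ↦ P y (w y)) x
    - P x (br (fun y ↦ P y (v y)) w x)
    - P x (br v (fun y ↦ P y (w y)) x)
    + P x (P x (br v w x))

/-- `P` is integrable with respect to a bracket on sections: its Nijenhuis operator vanishes on all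
smooth sections. -/
def IsIntegrable [IsManifold I ∞ M]
    (br : (Π x : M, GT I x) → (Π x : M, GT I x) → (Π x : M, GT I x))
    (P : Π x : M, GT I x →L[ℝ] GT I x) : Prop :=
  ∀ v w : Π x : M, GT I x, IsSmoothSection I v → IsSmoothSection I w →
    ∀ x, nijenhuis br P v w x = 0

end GenGeom

end

/-!
Put `G_X = ½ (X⁺ + X⁻) = X - α⁻¹ H X`, so that `X^± = G_X ± α⁻¹ X`. The endomorphism `P` maps `G_X`
into `T*M`, which is isotropic, so orthogonality of `P` says that `α⁻¹ H` is skew-symmetric. By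
bilinearity and skew-symmetry of the Courant bracket, and because it vanishes on pairs of one-forms,
`[X⁻, Y⁺]_C - [Y⁻, X⁺]_C = 2 [G_X, G_Y]_C`. When `α⁻¹ H` is closed, the right-hand side is
`2 G_[X, Y]`, as the graph of a closed two-form is involutive; applying `π ∘ ½ (Id + P)` shows that
`∇⁺` is torsion-free.

If `α` and `H` are parallel, then `π (∇_X (P v)) = π (P ∇_X v)` for every section `v`. The same
identity for `P v` and the injectivity of `α` upgrade this to `∇_X (P v) = P ∇_X v`. Finally, the
bracket of a torsion-free connection is `[v, w]_∇ = ∇_{π v} w - ∇_{π w} v`, and the Nijenhuis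
operator of a parallel `P` cancels term by term.
-/

noncomputable section

namespace GenGeom

section VectorBundle

open ContinuousLinearMap in
theorem contMDiffAt_inverse_hom_bundle {𝕜 B F₁ F₂ : Type*} [NontriviallyNormedField 𝕜]
    {k : WithTop ℕ∞} {E₁ E₂ : B → Type*}
    [∀ x, AddCommGroup (E₁ x)] [∀ x, Module 𝕜 (E₁ x)] [NormedAddCommGroup F₁] [NormedSpace 𝕜 F₁]
    [CompleteSpace F₁] [TopologicalSpace (TotalSpace F₁ E₁)] [∀ x, TopologicalSpace (E₁ x)]
    [∀ x, AddCommGroup (E₂ x)] [∀ x, Module 𝕜 (E₂ x)] [NormedAddCommGroup F₂] [NormedSpace 𝕜 F₂]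
    [TopologicalSpace (TotalSpace F₂ E₂)] [∀ x, TopologicalSpace (E₂ x)]
    {EB : Type*} [NormedAddCommGroup EB] [NormedSpace 𝕜 EB] {HB : Type*} [TopologicalSpace HB]
    {IB : ModelWithCorners 𝕜 EB HB} [TopologicalSpace B] [ChartedSpace HB B]
    {EN : Type*} [NormedAddCommGroup EN] [NormedSpace 𝕜 EN] {HN : Type*} [TopologicalSpace HN]
    {IN : ModelWithCorners 𝕜 EN HN} {N : Type*} [TopologicalSpace N] [ChartedSpace HN N]
    [FiberBundle F₁ E₁] [VectorBundle 𝕜 F₁ E₁] [FiberBundle F₂ E₂] [VectorBundle 𝕜 F₂ E₂]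
    [∀ x, IsTopologicalAddGroup (E₁ x)] [∀ x, ContinuousSMul 𝕜 (E₁ x)]
    [∀ x, IsTopologicalAddGroup (E₂ x)] [∀ x, ContinuousSMul 𝕜 (E₂ x)]
    {b : N → B} {φ : Π m, E₁ (b m) →L[𝕜] E₂ (b m)} {m₀ : N} (hφ : (φ m₀).IsInvertible)
    (h : ContMDiffAt IN (IB.prod 𝓘(𝕜, F₁ →L[𝕜] F₂)) k
      (fun m ↦ TotalSpace.mk' (F₁ →L[𝕜] F₂) (E := fun x ↦ E₁ x →L[𝕜] E₂ x) (b m) (φ m)) m₀) :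
    ContMDiffAt IN (IB.prod 𝓘(𝕜, F₂ →L[𝕜] F₁)) k
      (fun m ↦ TotalSpace.mk' (F₂ →L[𝕜] F₁) (E := fun x ↦ E₂ x →L[𝕜] E₁ x) (b m)
        (φ m).inverse) m₀ := by
  obtain ⟨hb, hcoord⟩ := (contMDiffAt_hom_bundle _).1 h
  refine (contMDiffAt_hom_bundle _).2 ⟨hb, ?_⟩
  have h₁ : b m₀ ∈ (trivializationAt F₁ E₁ (b m₀)).baseSet :=
    FiberBundle.mem_baseSet_trivializationAt' _
  have h₂ : b m₀ ∈ (trivializationAt F₂ E₂ (b m₀)).baseSet :=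
    FiberBundle.mem_baseSet_trivializationAt' _
  have hinv : (inCoordinates F₁ E₁ F₂ E₂ (b m₀) (b m₀) (b m₀) (b m₀) (φ m₀)).IsInvertible := by
    rw [inCoordinates_eq h₁ h₂]
    simpa using hφ
  refine ((hinv.contDiffAt_map_inverse (n := k)).contMDiffAt.comp m₀
    hcoord).congr_of_eventuallyEq ?_
  filter_upwards
    [hb.continuousAt.preimage_mem_nhds ((trivializationAt F₁ E₁ (b m₀)).open_baseSet.mem_nhds h₁),
    hb.continuousAt.preimage_mem_nhds ((trivializationAt F₂ E₂ (b m₀)).open_baseSet.mem_nhds h₂)]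
    with m hm₁ hm₂
  dsimp only [Function.comp]
  rw [inCoordinates_eq hm₁ hm₂, inCoordinates_eq hm₂ hm₁]
  simp [comp_assoc]

theorem exists_contMDiff_section_eq {E : Type*} [NormedAddCommGroup E] [NormedSpace ℝ E]
    [FiniteDimensional ℝ E] {H : Type*} [TopologicalSpace H] (I : ModelWithCorners ℝ E H)
    {M : Type*} [TopologicalSpace M] [ChartedSpace H M] [T2Space M] [IsManifold I ∞ M]
    (F : Type*) [NormedAddCommGroup F] [NormedSpace ℝ F] {V : M → Type*}
    [TopologicalSpace (TotalSpace F V)] [∀ x, AddCommGroup (V x)] [∀ x, Module ℝ (V x)]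
    [∀ x, TopologicalSpace (V x)] [FiberBundle F V] [VectorBundle ℝ F V]
    {k : ℕ∞} [ContMDiffVectorBundle k F V I] {x : M} (v : V x) :
    ∃ σ : Π y, V y, ContMDiff I (I.prod 𝓘(ℝ, F)) k (fun y ↦ TotalSpace.mk' F y (σ y)) ∧
      σ x = v := by
  obtain ⟨s, hs, hσ⟩ := FiberBundle.exists_contMDiffOn_extend I F v (k := k)
  obtain ⟨ψ, -, hψ⟩ := (SmoothBumpFunction.nhds_basis_tsupport (I := I) x).mem_iff.1
    (interior_mem_nhds.2 hs)
  refine ⟨fun y ↦ ψ y • FiberBundle.extend F v y, ?_, by simp⟩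
  exact ContMDiffOn.smul_section_of_tsupport (ψ.contMDiff.of_le (mod_cast le_top)).contMDiffOn
    isOpen_interior hψ (hσ.mono interior_subset)

end VectorBundle

variable {E : Type*} [NormedAddCommGroup E] [NormedSpace ℝ E]
  {H : Type*} [TopologicalSpace H] {I : ModelWithCorners ℝ E H}
  {M : Type*} [TopologicalSpace M] [ChartedSpace H M]

section Blocks

variable {P : Π x : M, GT I x →L[ℝ] GT I x} {x : M}

theorem fst_apply (v : GT I x) : (P x v).1 = blockH P x v.1 + blockAlpha P x v.2 := by
  conv_lhs => rw [← Prod.fst_add_snd v, (P x).map_add]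
  rfl

theorem snd_apply (v : GT I x) : (P x v).2 = blockBeta P x v.1 + blockK P x v.2 := by
  conv_lhs => rw [← Prod.fst_add_snd v, (P x).map_add]
  rfl

theorem fst_apply_neg_alphaInvH (hα : (blockAlpha P x).IsInvertible) (X : TangentSpace I x) :
    (P x (X, -alphaInvH P x X)).1 = 0 := by
  have hcancel : blockAlpha P x (alphaInvH P x X) = blockH P x X :=
    hα.self_apply_inverse (blockH P x X)
  rw [fst_apply, map_neg, hcancel, add_neg_cancel]

theorem alphaInvH_skew (hP : ∀ v w : GT I x, pairing (P x v) (P x w) = pairing v w)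
    (hα : (blockAlpha P x).IsInvertible) (X Y : TangentSpace I x) :
    alphaInvH P x X Y = -alphaInvH P x Y X := by
  have hisotropic := hP (X, -alphaInvH P x X) (Y, -alphaInvH P x Y)
  simp only [pairing, fst_apply_neg_alphaInvH hα, map_zero, add_zero, neg_apply] at hisotropic
  linarith

end Blocks

section Sections

/-- The section `X + b(X, ·)` of `TM ⊕ T*M`: the lift of a vector field to the graph of a field `b`
of bilinear forms. -/
def graph (b : Π x : M, TangentSpace I x →L[ℝ] Cotangent I x) (X : Π x : M, TangentSpace I x)
    (x : M) : GT I x :=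
  (X x, b x (X x))

/-- A one-form regarded as a section of `TM ⊕ T*M`. -/
def ofForm (ξ : Π x : M, Cotangent I x) (x : M) : GT I x :=
  (0, ξ x)

variable {P : Π x : M, GT I x →L[ℝ] GT I x}

theorem liftPlus_eq (X : Π x : M, TangentSpace I x) :
    liftPlus P X = graph (-alphaInvH P) X + ofForm fun x ↦ alphaInv P x (X x) := by
  funext x
  exact Prod.ext (add_zero _).symm (sub_eq_neg_add _ _)

theorem liftMinus_eq (X : Π x : M, TangentSpace I x) :
    liftMinus P X = graph (-alphaInvH P) X - ofForm fun x ↦ alphaInv P x (X x) := by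
  funext x
  exact Prod.ext (sub_zero _).symm (neg_sub_comm _ _)

theorem liftPlus_add (X Y : Π x : M, TangentSpace I x) :
    liftPlus P (X + Y) = liftPlus P X + liftPlus P Y := by
  funext x
  refine Prod.ext rfl ?_
  simp only [liftPlus, Pi.add_apply, map_add, Prod.snd_add]
  abel

variable [IsManifold I ∞ M] {X : Π x : M, TangentSpace I x} {ξ : Π x : M, Cotangent I x}
  {v w : Π x : M, GT I x}

theorem IsSmoothVF.mdifferentiableAt (hX : IsSmoothVF I X) (x : M) :
    MDifferentiableAt I (I.prod 𝓘(ℝ, E)) (fun y ↦ TotalSpace.mk' E y (X y)) x :=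
  ContMDiff.mdifferentiable hX (by simp) x

theorem IsSmoothForm.mdifferentiableAt (hξ : IsSmoothForm I ξ) (x : M) :
    MDifferentiableAt I (I.prod 𝓘(ℝ, E →L[ℝ] ℝ))
      (fun y ↦ TotalSpace.mk' (E →L[ℝ] ℝ) (E := fun x : M ↦ Cotangent I x) y (ξ y)) x :=
  ContMDiff.mdifferentiable hξ (by simp) x

theorem IsSmoothForm.contr_mdifferentiableAt (hξ : IsSmoothForm I ξ) (hX : IsSmoothVF I X)
    (x : M) : MDifferentiableAt I 𝓘(ℝ, ℝ) (contr ξ X) x :=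
  GenGeom.contr_mdifferentiableAt (hξ.mdifferentiableAt x) (hX.mdifferentiableAt x)

theorem IsSmoothForm.isSmoothSection_ofForm (hξ : IsSmoothForm I ξ) :
    IsSmoothSection I (ofForm ξ) :=
  ⟨contMDiff_zeroSection ℝ _, hξ⟩

theorem IsSmoothSection.add (hv : IsSmoothSection I v) (hw : IsSmoothSection I w) :
    IsSmoothSection I (v + w) :=
  ⟨ContMDiff.add_section hv.1 hw.1, ContMDiff.add_section hv.2 hw.2⟩

theorem IsSmoothSection.sub (hv : IsSmoothSection I v) (hw : IsSmoothSection I w) :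
    IsSmoothSection I (v - w) :=
  ⟨ContMDiff.sub_section hv.1 hw.1, ContMDiff.sub_section hv.2 hw.2⟩

theorem IsSmoothEnd.apply (hP : IsSmoothEnd P) (hv : IsSmoothSection I v) :
    IsSmoothSection I (fun x ↦ P x (v x)) := by
  simp only [IsSmoothSection, fst_apply, snd_apply]
  exact ⟨ContMDiff.add_section (ContMDiff.clm_bundle_apply hP.smooth_H hv.1)
      (ContMDiff.clm_bundle_apply hP.smooth_alpha hv.2),
    ContMDiff.add_section (ContMDiff.clm_bundle_apply hP.smooth_beta hv.1)
      (ContMDiff.clm_bundle_apply hP.smooth_K hv.2)⟩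

variable [FiniteDimensional ℝ E]

theorem IsSmoothEnd.alphaInv_apply (hP : IsSmoothEnd P)
    (hα : ∀ x, (blockAlpha P x).IsInvertible) (hX : IsSmoothVF I X) :
    IsSmoothForm I (fun x ↦ alphaInv P x (X x)) :=
  have : CompleteSpace E := FiniteDimensional.complete ℝ E
  ContMDiff.clm_bundle_apply
    (fun x ↦ contMDiffAt_inverse_hom_bundle (hα x) (hP.smooth_alpha x)) hX

theorem IsSmoothEnd.graph_neg_alphaInvH (hP : IsSmoothEnd P)
    (hα : ∀ x, (blockAlpha P x).IsInvertible) (hX : IsSmoothVF I X) :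
    IsSmoothSection I (graph (-alphaInvH P) X) :=
  ⟨hX, ContMDiff.neg_section
    (hP.alphaInv_apply hα (ContMDiff.clm_bundle_apply hP.smooth_H hX))⟩

theorem IsSmoothEnd.liftPlus (hP : IsSmoothEnd P) (hα : ∀ x, (blockAlpha P x).IsInvertible)
    (hX : IsSmoothVF I X) : IsSmoothSection I (liftPlus P X) := by
  rw [liftPlus_eq]
  exact (hP.graph_neg_alphaInvH hα hX).add (hP.alphaInv_apply hα hX).isSmoothSection_ofForm

theorem IsSmoothEnd.liftMinus (hP : IsSmoothEnd P) (hα : ∀ x, (blockAlpha P x).IsInvertible)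
    (hX : IsSmoothVF I X) : IsSmoothSection I (liftMinus P X) := by
  rw [liftMinus_eq]
  exact (hP.graph_neg_alphaInvH hα hX).sub (hP.alphaInv_apply hα hX).isSmoothSection_ofForm

theorem cotangent_ext [T2Space M] {x : M} {ζ ζ' : Cotangent I x}
    (h : ∀ Z : Π y : M, TangentSpace I y, IsSmoothVF I Z → ζ (Z x) = ζ' (Z x)) : ζ = ζ' := by
  refine ContinuousLinearMap.ext fun z ↦ ?_
  obtain ⟨Z, hZ, rfl⟩ := exists_contMDiff_section_eq I E (k := ⊤) z
  exact h Z hZ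

end Sections

section DirDeriv

variable {f g : M → ℝ} {x : M}

theorem dirDeriv_add (Z : Π x : M, TangentSpace I x) (hf : MDifferentiableAt I 𝓘(ℝ, ℝ) f x)
    (hg : MDifferentiableAt I 𝓘(ℝ, ℝ) g x) :
    dirDeriv Z (f + g) x = dirDeriv Z f x + dirDeriv Z g x := by
  rw [dirDeriv, mvfderiv_add hf hg]
  rfl

theorem dirDeriv_neg (Z : Π x : M, TangentSpace I x) (f : M → ℝ) (x : M) :
    dirDeriv Z (-f) x = -dirDeriv Z f x := by
  rw [dirDeriv, mvfderiv_neg]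
  rfl

theorem dirDeriv_add_left (X Y : Π x : M, TangentSpace I x) (f : M → ℝ) (x : M) :
    dirDeriv (X + Y) f x = dirDeriv X f x + dirDeriv Y f x :=
  map_add (mvfderiv I f x) (X x) (Y x)

theorem extDerivTwo_neg (b : Π x : M, TangentSpace I x →L[ℝ] Cotangent I x)
    (X Y Z : Π x : M, TangentSpace I x) (x : M) :
    extDerivTwo (-b) X Y Z x = -extDerivTwo b X Y Z x := by
  have hneg (A B C : Π x : M, TangentSpace I x) :
      dirDeriv A (fun y ↦ (-b) y (B y) (C y)) x = -dirDeriv A (fun y ↦ b y (B y) (C y)) x :=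
    dirDeriv_neg A (fun y ↦ b y (B y) (C y)) x
  simp only [extDerivTwo, hneg]
  simp only [Pi.neg_apply, neg_apply]
  ring

end DirDeriv

section Courant

variable [FiniteDimensional ℝ E] [IsManifold I ∞ M]

section LieDerivForm

variable [T2Space M] {X Y : Π x : M, TangentSpace I x} {ξ η : Π x : M, Cotangent I x}

theorem lieDerivForm_add_left (hX : IsSmoothVF I X) (hY : IsSmoothVF I Y)
    (hη : IsSmoothForm I η) (x : M) :
    lieDerivForm (X + Y) η x = lieDerivForm X η x + lieDerivForm Y η x := by
  have : CompleteSpace E := FiniteDimensional.complete ℝ E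
  refine cotangent_ext fun Z hZ ↦ ?_
  have hη := hη.mdifferentiableAt x
  have hZ := hZ.mdifferentiableAt x
  rw [add_apply, lieDerivForm_apply hη hZ, lieDerivForm_apply hη hZ, lieDerivForm_apply hη hZ,
    dirDeriv_add_left, VectorField.mlieBracket_add_left (hX.mdifferentiableAt x)
      (hY.mdifferentiableAt x), map_add]
  ring

theorem lieDerivForm_add_right (hξ : IsSmoothForm I ξ) (hη : IsSmoothForm I η) (x : M) :
    lieDerivForm X (ξ + η) x = lieDerivForm X ξ x + lieDerivForm X η x := by
  refine cotangent_ext fun Z hZ ↦ ?_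
  have hξη : IsSmoothForm I (ξ + η) := ContMDiff.add_section hξ hη
  have hcontr : contr (ξ + η) Z = contr ξ Z + contr η Z := rfl
  have hZx := hZ.mdifferentiableAt x
  rw [add_apply, lieDerivForm_apply (hξη.mdifferentiableAt x) hZx,
    lieDerivForm_apply (hξ.mdifferentiableAt x) hZx,
    lieDerivForm_apply (hη.mdifferentiableAt x) hZx, hcontr,
    dirDeriv_add X (hξ.contr_mdifferentiableAt hZ x) (hη.contr_mdifferentiableAt hZ x),
    Pi.add_apply, add_apply]
  ring

theorem lieDerivForm_zero_left (hη : IsSmoothForm I η) (x : M) : lieDerivForm 0 η x = 0 := by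
  refine cotangent_ext fun Z hZ ↦ ?_
  rw [lieDerivForm_apply (hη.mdifferentiableAt x) (hZ.mdifferentiableAt x),
    VectorField.mlieBracket_zero_left]
  simp [dirDeriv]

end LieDerivForm

theorem courant_swap (v w : Π x : M, GT I x) (x : M) : courant v w x = -courant w v x := by
  refine Prod.ext VectorField.mlieBracket_swap_apply ?_
  have hcontr : (fun y ↦ (w y).2 (v y).1 - (v y).2 (w y).1)
      = -fun y ↦ (v y).2 (w y).1 - (w y).2 (v y).1 :=
    funext fun y ↦ (neg_sub _ _).symm
  simp only [courant, Prod.snd_neg]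
  rw [hcontr, mvfderiv_neg]
  module

section Biadditive

variable [T2Space M] {u v w : Π x : M, GT I x}

theorem courant_add_right (hu : IsSmoothSection I u) (hv : IsSmoothSection I v)
    (hw : IsSmoothSection I w) (x : M) :
    courant u (v + w) x = courant u v x + courant u w x := by
  have : CompleteSpace E := FiniteDimensional.complete ℝ E
  refine Prod.ext (VectorField.mlieBracket_add_right (hv.1.mdifferentiableAt x)
    (hw.1.mdifferentiableAt x)) ?_
  have hpair : (fun y ↦ ((v + w) y).2 (u y).1 - (u y).2 ((v + w) y).1)
      = (fun y ↦ (v y).2 (u y).1 - (u y).2 (v y).1)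
        + fun y ↦ (w y).2 (u y).1 - (u y).2 (w y).1 := by
    funext y
    simp only [Pi.add_apply, Prod.fst_add, Prod.snd_add, add_apply, map_add]
    ring
  have hdiff {w : Π x : M, GT I x} (hw : IsSmoothSection I w) :
      MDifferentiableAt I 𝓘(ℝ, ℝ) (fun y ↦ (w y).2 (u y).1 - (u y).2 (w y).1) x :=
    (hw.2.contr_mdifferentiableAt hu.1 x).sub (hu.2.contr_mdifferentiableAt hw.1 x)
  have hfst := lieDerivForm_add_left hv.1 hw.1 hu.2 x
  have hsnd := lieDerivForm_add_right (X := fun y ↦ (u y).1) hv.2 hw.2 x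
  simp only [courant, Prod.snd_add]
  rw [hpair, mvfderiv_add (hdiff hv) (hdiff hw)]
  refine (congrArg₂ (fun a b ↦ a - b - _) hsnd hfst).trans ?_
  module

theorem courant_sub_right (hu : IsSmoothSection I u) (hv : IsSmoothSection I v)
    (hw : IsSmoothSection I w) (x : M) :
    courant u (v - w) x = courant u v x - courant u w x := by
  rw [eq_sub_iff_add_eq, ← courant_add_right hu (hv.sub hw) hw, sub_add_cancel]

theorem courant_add_left (hu : IsSmoothSection I u) (hv : IsSmoothSection I v)
    (hw : IsSmoothSection I w) (x : M) :
    courant (u + v) w x = courant u w x + courant v w x := by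
  rw [courant_swap, courant_add_right hw hu hv, neg_add, ← courant_swap, ← courant_swap]

theorem courant_sub_left (hu : IsSmoothSection I u) (hv : IsSmoothSection I v)
    (hw : IsSmoothSection I w) (x : M) :
    courant (u - v) w x = courant u w x - courant v w x := by
  rw [courant_swap, courant_sub_right hw hu hv, neg_sub', ← courant_swap, ← courant_swap]

theorem courant_polarization {v' w' : Π x : M, GT I x} (hv : IsSmoothSection I v)
    (hv' : IsSmoothSection I v') (hw : IsSmoothSection I w) (hw' : IsSmoothSection I w') (x : M) :
    courant (v - v') (w + w') x + courant (v + v') (w - w') x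
      = (2 : ℝ) • (courant v w x - courant v' w' x) := by
  rw [courant_sub_left hv hv' (hw.add hw'), courant_add_left hv hv' (hw.sub hw'),
    courant_add_right hv hw hw', courant_add_right hv' hw hw', courant_sub_right hv hw hw',
    courant_sub_right hv' hw hw']
  module

end Biadditive

theorem courant_ofForm [T2Space M] {ξ η : Π x : M, Cotangent I x} (hξ : IsSmoothForm I ξ)
    (hη : IsSmoothForm I η) (x : M) : courant (ofForm ξ) (ofForm η) x = 0 := by
  refine Prod.ext (congrFun VectorField.mlieBracket_zero_left x) ?_
  have hpair : (fun y ↦ (ofForm η y).2 (ofForm ξ y).1 - (ofForm ξ y).2 (ofForm η y).1)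
      = (0 : M → ℝ) := by
    funext y
    simp [ofForm]
  have hη := lieDerivForm_zero_left hη x
  have hξ := lieDerivForm_zero_left hξ x
  simp only [courant]
  rw [hpair, mvfderiv_zero]
  refine (congrArg₂ (fun a b ↦ a - b - _) hη hξ).trans ?_
  simp

section Graph

variable {b : Π x : M, TangentSpace I x →L[ℝ] Cotangent I x} {X Y Z : Π x : M, TangentSpace I x}

theorem courant_graph_snd_apply (hb : ∀ x (U V : TangentSpace I x), b x U V = -b x V U)
    (hX : IsSmoothSection I (graph b X)) (hY : IsSmoothSection I (graph b Y))
    (hZ : IsSmoothVF I Z) (x : M) :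
    (courant (graph b X) (graph b Y) x).2 (Z x)
      = b x (VectorField.mlieBracket I X Y x) (Z x) + extDerivTwo b X Y Z x := by
  set f : M → ℝ := fun y ↦ b y (X y) (Y y) with hf
  have hfx : MDifferentiableAt I 𝓘(ℝ, ℝ) f x := hX.2.contr_mdifferentiableAt hY.1 x
  have hpair : (fun y ↦ b y (Y y) (X y) - b y (X y) (Y y)) = -(f + f) := by
    funext y
    simp only [hf, hb y (Y y), Pi.neg_apply, Pi.add_apply]
    ring
  have hpairZ : dirDeriv Z (fun y ↦ b y (Y y) (X y) - b y (X y) (Y y)) x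
      = -(2 * dirDeriv Z f x) := by
    rw [hpair, dirDeriv_neg, dirDeriv_add Z hfx hfx, two_mul]
  have hbX : IsSmoothForm I (fun y ↦ b y (X y)) := hX.2
  have hbY : IsSmoothForm I (fun y ↦ b y (Y y)) := hY.2
  have hZx := hZ.mdifferentiableAt x
  calc (courant (graph b X) (graph b Y) x).2 (Z x)
      = lieDerivForm X (fun y ↦ b y (Y y)) x (Z x) - lieDerivForm Y (fun y ↦ b y (X y)) x (Z x)
        - 1 / 2 * dirDeriv Z (fun y ↦ b y (Y y) (X y) - b y (X y) (Y y)) x := rfl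
    _ = dirDeriv X (fun y ↦ b y (Y y) (Z y)) x - b x (Y x) (VectorField.mlieBracket I X Z x)
        - (dirDeriv Y (fun y ↦ b y (X y) (Z y)) x - b x (X x) (VectorField.mlieBracket I Y Z x))
        + dirDeriv Z f x := by
      rw [lieDerivForm_apply (hbY.mdifferentiableAt x) hZx,
        lieDerivForm_apply (hbX.mdifferentiableAt x) hZx, hpairZ]
      unfold contr
      ring
    _ = b x (VectorField.mlieBracket I X Y x) (Z x) + extDerivTwo b X Y Z x := by
      rw [hb x (Y x), hb x (X x), extDerivTwo]
      ring

theorem courant_graph [T2Space M] (hb : ∀ x (U V : TangentSpace I x), b x U V = -b x V U)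
    (hclosed : IsClosedTwo b) (hX : IsSmoothSection I (graph b X))
    (hY : IsSmoothSection I (graph b Y)) (x : M) :
    courant (graph b X) (graph b Y) x = graph b (VectorField.mlieBracket I X Y) x := by
  refine Prod.ext rfl (cotangent_ext fun Z hZ ↦ ?_)
  rw [courant_graph_snd_apply hb hX hY hZ, hclosed X Y Z hX.1 hY.1 hZ, add_zero]
  rfl

end Graph

end Courant

section Connection

variable [FiniteDimensional ℝ E] [IsManifold I ∞ M]

/-- An operation `∇` on vector fields, such as an affine connection, is torsion-free:
`∇_X Y - ∇_Y X = [X, Y]` for all smooth vector fields. -/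
def IsTorsionFree (nabla : (Π x : M, TangentSpace I x) → (Π x : M, TangentSpace I x) →
    (Π x : M, TangentSpace I x)) : Prop :=
  ∀ X Y : Π x : M, TangentSpace I x, IsSmoothVF I X → IsSmoothVF I Y →
    ∀ x, nabla X Y x - nabla Y X x = VectorField.mlieBracket I X Y x

/-- The connection `∇_X (Y + η) = ∇_X Y + ∇_X η` on `TM ⊕ T*M` induced by a connection on `TM`. -/
def sumConn (nabla : (Π x : M, TangentSpace I x) → (Π x : M, TangentSpace I x) →
      (Π x : M, TangentSpace I x)) (X : Π x : M, TangentSpace I x) (v : Π x : M, GT I x) (x : M) :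
    GT I x :=
  (nabla X (fun y ↦ (v y).1) x, dualConn nabla X (fun y ↦ (v y).2) x)

/-- `∇P = 0` for a field `P` of endomorphisms of `TM ⊕ T*M`: `∇_X (P v) = P (∇_X v)` for all smooth
vector fields `X` and smooth sections `v`. -/
def IsParallelGT (nabla : (Π x : M, TangentSpace I x) → (Π x : M, TangentSpace I x) →
      (Π x : M, TangentSpace I x)) (P : Π x : M, GT I x →L[ℝ] GT I x) : Prop :=
  ∀ (X : Π x : M, TangentSpace I x) (v : Π x : M, GT I x), IsSmoothVF I X → IsSmoothSection I v →
    ∀ x, sumConn nabla X (fun y ↦ P y (v y)) x = P x (sumConn nabla X v x)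

variable {nabla : (Π x : M, TangentSpace I x) → (Π x : M, TangentSpace I x) →
    (Π x : M, TangentSpace I x)} {P : Π x : M, GT I x →L[ℝ] GT I x}

theorem IsTorsionFree.connBracket_eq (htors : IsTorsionFree nabla) {v w : Π x : M, GT I x}
    (hv : IsSmoothSection I v) (hw : IsSmoothSection I w) (x : M) :
    connBracket nabla v w x =
      sumConn nabla (fun y ↦ (v y).1) w x - sumConn nabla (fun y ↦ (w y).1) v x :=
  Prod.ext (htors _ _ hv.1 hw.1 x).symm rfl

theorem IsParallelGT.isIntegrable_connBracket (hpar : IsParallelGT nabla P)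
    (htors : IsTorsionFree nabla) (hP : IsSmoothEnd P) : IsIntegrable (connBracket nabla) P := by
  intro v w hv hw x
  have hPv := hP.apply hv
  have hPw := hP.apply hw
  rw [nijenhuis, htors.connBracket_eq hPv hPw, htors.connBracket_eq hPv hw,
    htors.connBracket_eq hv hPw, htors.connBracket_eq hv hw, hpar _ w hPv.1 hw,
    hpar _ v hPw.1 hv, hpar _ v hw.1 hv, hpar _ w hv.1 hw]
  rw [(P x).map_sub, (P x).map_sub, (P x).map_sub, (P x).map_sub]
  abel

theorem isParallelGT_of_blocks
    (hadd : ∀ X Y Z : Π x : M, TangentSpace I x, IsSmoothVF I X → IsSmoothVF I Y →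
      IsSmoothVF I Z → ∀ x, nabla X (Y + Z) x = nabla X Y x + nabla X Z x)
    (hP : IsSmoothEnd P) (hsq : ∀ x (v : GT I x), P x (P x v) = v)
    (hα : ∀ x, Function.Injective (blockAlpha P x)) (hparα : IsParallelCT nabla (blockAlpha P))
    (hparH : IsParallelTT nabla (blockH P)) : IsParallelGT nabla P := by
  intro X v hX hv x
  have fst_eq {u : Π x : M, GT I x} (hu : IsSmoothSection I u) :
      (sumConn nabla X (fun y ↦ P y (u y)) x).1 = (P x (sumConn nabla X u x)).1 := by
    rw [fst_apply]
    calc nabla X (fun y ↦ (P y (u y)).1) x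
        = nabla X ((fun y ↦ blockH P y (u y).1) + fun y ↦ blockAlpha P y (u y).2) x := by
          simp only [fst_apply]
          rfl
      _ = nabla X (fun y ↦ blockH P y (u y).1) x + nabla X (fun y ↦ blockAlpha P y (u y).2) x :=
        hadd _ _ _ hX (ContMDiff.clm_bundle_apply hP.smooth_H hu.1)
          (ContMDiff.clm_bundle_apply hP.smooth_alpha hu.2) x
      _ = _ := congrArg₂ _ (sub_eq_zero.1 (hparH X _ hX hu.1 x))
          (sub_eq_zero.1 (hparα X _ hX hu.2 x))
  refine Prod.ext (fst_eq hv) (hα x ?_)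
  have hPfst : (P x (sumConn nabla X (fun y ↦ P y (v y)) x)).1
      = (P x (P x (sumConn nabla X v x))).1 := by
    rw [← fst_eq (hP.apply hv), hsq]
    simp only [hsq]
  rwa [fst_apply, fst_apply, fst_eq hv, add_right_inj] at hPfst

theorem nablaPlus_add [T2Space M] (hP : IsSmoothEnd P) (hα : ∀ x, (blockAlpha P x).IsInvertible)
    {X Y Z : Π x : M, TangentSpace I x} (hX : IsSmoothVF I X) (hY : IsSmoothVF I Y)
    (hZ : IsSmoothVF I Z) (x : M) :
    nablaPlus P X (Y + Z) x = nablaPlus P X Y x + nablaPlus P X Z x := by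
  simp only [nablaPlus, projPlus]
  rw [liftPlus_add, courant_add_right (hP.liftMinus hα hX) (hP.liftPlus hα hY)
    (hP.liftPlus hα hZ), (P x).map_add, add_add_add_comm, smul_add, Prod.fst_add]

theorem courant_liftMinus_liftPlus_sub_swap [T2Space M] (hP : IsSmoothEnd P)
    (horth : ∀ x (v w : GT I x), pairing (P x v) (P x w) = pairing v w)
    (hα : ∀ x, (blockAlpha P x).IsInvertible) (hclosed : IsClosedTwo (alphaInvH P))
    {X Y : Π x : M, TangentSpace I x} (hX : IsSmoothVF I X) (hY : IsSmoothVF I Y) (x : M) :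
    courant (liftMinus P X) (liftPlus P Y) x - courant (liftMinus P Y) (liftPlus P X) x
      = (2 : ℝ) • graph (-alphaInvH P) (VectorField.mlieBracket I X Y) x := by
  have hskew (y : M) (U V : TangentSpace I y) :
      (-alphaInvH P) y U V = -(-alphaInvH P) y V U :=
    congrArg Neg.neg (alphaInvH_skew (horth y) (hα y) U V)
  have hclosed_neg : IsClosedTwo (-alphaInvH P) := fun A B C hA hB hC y ↦ by
    rw [extDerivTwo_neg, hclosed A B C hA hB hC, neg_zero]
  have hGX := hP.graph_neg_alphaInvH hα hX
  have hGY := hP.graph_neg_alphaInvH hα hY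
  have hξ := hP.alphaInv_apply hα hX
  have hη := hP.alphaInv_apply hα hY
  rw [courant_swap (liftMinus P Y), sub_neg_eq_add, liftMinus_eq, liftMinus_eq, liftPlus_eq,
    liftPlus_eq, courant_polarization hGX hξ.isSmoothSection_ofForm hGY hη.isSmoothSection_ofForm,
    courant_ofForm hξ hη, sub_zero, courant_graph hskew hclosed_neg hGX hGY]

theorem isTorsionFree_nablaPlus [T2Space M] (hP : IsSmoothEnd P)
    (horth : ∀ x (v w : GT I x), pairing (P x v) (P x w) = pairing v w)
    (hα : ∀ x, (blockAlpha P x).IsInvertible) (hclosed : IsClosedTwo (alphaInvH P)) :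
    IsTorsionFree (nablaPlus P) := by
  intro X Y hX hY x
  calc nablaPlus P X Y x - nablaPlus P Y X x
      = (projPlus P x (courant (liftMinus P X) (liftPlus P Y) x
          - courant (liftMinus P Y) (liftPlus P X) x)).1 := by
        simp only [nablaPlus, projPlus]
        rw [(P x).map_sub, sub_add_sub_comm, smul_sub, Prod.fst_sub]
    _ = (graph (-alphaInvH P) (VectorField.mlieBracket I X Y) x
          + P x (graph (-alphaInvH P) (VectorField.mlieBracket I X Y) x)).1 := by
        rw [courant_liftMinus_liftPlus_sub_swap hP horth hα hclosed hX hY, projPlus, (P x).map_smul,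
          ← smul_add, smul_smul, one_div_mul_cancel two_ne_zero, one_smul]
    _ = VectorField.mlieBracket I X Y x := by
        rw [Prod.fst_add]
        exact (congrArg _ (fst_apply_neg_alphaInvH (hα x) _)).trans (add_zero _)

end Connection

end GenGeom

end

theorem mainTheorem5_general {E : Type*} [NormedAddCommGroup E] [NormedSpace ℝ E]
    [FiniteDimensional ℝ E] {H : Type*} [TopologicalSpace H] {I : ModelWithCorners ℝ E H}
    {M : Type*} [TopologicalSpace M] [T2Space M] [ChartedSpace H M] [IsManifold I ∞ M]
    (P : Π x : M, GenGeom.GT I x →L[ℝ] GenGeom.GT I x)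
    (hP : GenGeom.IsGenAlmostParaComplex P)
    (hα : ∀ x, (GenGeom.blockAlpha P x).IsInvertible)
    (hparα : GenGeom.IsParallelCT (GenGeom.nablaPlus P) (GenGeom.blockAlpha P))
    (hparH : GenGeom.IsParallelTT (GenGeom.nablaPlus P) (GenGeom.blockH P))
    (hclosed : GenGeom.IsClosedTwo (GenGeom.alphaInvH P)) :
    GenGeom.IsIntegrable (GenGeom.connBracket (GenGeom.nablaPlus P)) P := by
  have htors : GenGeom.IsTorsionFree (GenGeom.nablaPlus P) :=
    GenGeom.isTorsionFree_nablaPlus hP.smooth hP.orthogonal hα hclosed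
  have hpar : GenGeom.IsParallelGT (GenGeom.nablaPlus P) P :=
    GenGeom.isParallelGT_of_blocks
      (fun _ _ _ hX hY hZ ↦ GenGeom.nablaPlus_add hP.smooth hα hX hY hZ)
      hP.smooth hP.sq_eq_id (fun x ↦ (hα x).injective) hparα hparH
  exact hpar.isIntegrable_connBracket htors hP.smooth

theorem mainTheorem5 {n : ℕ} {M : Type*} [TopologicalSpace M] [T2Space M]
    [SecondCountableTopology M] [ChartedSpace (EuclideanSpace ℝ (Fin n)) M]
    [IsManifold (𝓡 n) ∞ M]
    (P : Π x : M, GenGeom.GT (𝓡 n) x →L[ℝ] GenGeom.GT (𝓡 n) x)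
    (hP : GenGeom.IsGenAlmostParaComplex P)
    (hα : ∀ x, (GenGeom.blockAlpha P x).IsInvertible)
    (hparα : GenGeom.IsParallelCT (GenGeom.nablaPlus P) (GenGeom.blockAlpha P))
    (hparH : GenGeom.IsParallelTT (GenGeom.nablaPlus P) (GenGeom.blockH P))
    (hclosed : GenGeom.IsClosedTwo (GenGeom.alphaInvH P)) :
    GenGeom.IsIntegrable (GenGeom.connBracket (GenGeom.nablaPlus P)) P :=
  mainTheorem5_general P hP hα hparα hparH hclosed
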